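/- Consider the random tree that evolves in continuous time from a single living root: every living node, independently of all others, lives for an exponentially distributed time with parameter $Q>0$; at the end of its life it dies and produces $\nu$ new living nodes, its children, where $\nu$ has the Poisson distribution with parameter $q_1$ and so $q(z)=\mathbf E\{z^\nu\}=e^{-(1-z)q_1}$. Let $\mu(t)$ be the total number of nodes, living and dead, at time $t$. For all $Q>0$, $q_1\ge 0$ and $n\ge 0$ the limit $p_n=\lim_{t\to\infty}\mathcal P\{\mu(t)=n\}$ exists; put $g(z)=\sum_{n\ge1}p_nz^n$. Then the following hold. 1. If $q_1>0$, then for all $z\in[0,1]$, $g(z)=z\,q(g(z))=z\,e^{-q_1}e^{q_1g(z)}$. 2. If $0<q_1\le1$, then the only root of $x=e^{-q_1}e^{q_1x}$ in $[0,1]$ is $x=1$, and $\lim_{z\uparrow1}g(z)=\sum_{n\ge1}p_n=1$. If $q_1>1$, then this equation has exactly two roots in $[0,1]$, namely $1$ and some $g_2<1$, and $\lim_{z\uparrow1}g(z)=\sum_{n\ge1}p_n=g_2$. 3. There are positive rational numbers $C_n$, $n\ge1$, which depend neither on $q_1$ nor on $Q$, such that for all $q_1>0$ and $n\ge1$ $$p_n=C_n\,q_1^{-1}\left[e^{-q_1}q_1\right]^n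 .$$ 4. For every $n\ge1$, $p_n$ as a function of $q_1\in[0,\infty)$ has its maximum at $q_1=1-\frac1n$ and at no other point (for $q_1=0$, which matters only for $n=1$, the Poisson distribution is the unit mass at $0$). -/

import Mathlib

open MeasureTheory ProbabilityTheory Filter Topology
open scoped NNReal

namespace RandomTree

/-- A realization of the evolution. Potential nodes are labelled by words: `[]` is the root, and
`[i₁, i₂, …, iₖ]` is the `iₖ`-th child of … of the `i₂`-th child of the `i₁`-th child of the root
(children are numbered from `0`). To each label are attached the lifetime of the node and the
number of new living nodes which it produces at the end of its life. -/
abbrev Evolution : Type := List ℕ → ℝ × ℕ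

/-- The lifetime of the node `u`. -/
def lifetime (ω : Evolution) (u : List ℕ) : ℝ := (ω u).1

/-- The number of living nodes produced by the node `u` when it dies. -/
def offspring (ω : Evolution) (u : List ℕ) : ℕ := (ω u).2

/-- The evolution that starts from the `i`-th child of the root. -/
def subEvolution (ω : Evolution) (i : ℕ) : Evolution := fun u => ω (i :: u)

/-- The label `u` is that of a node that is eventually produced: each entry on the path from the
root to `u` is smaller than the number of children of the node at which it is read. -/
def IsNode : Evolution → List ℕ → Prop
  | _, [] => True
  | ω, i :: u => i < offspring ω [] ∧ IsNode (subEvolution ω i) u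

/-- The time at which the node `u` is born: the sum of the lifetimes of its strict ancestors. -/
def birthTime : Evolution → List ℕ → ℝ
  | _, [] => 0
  | ω, i :: u => lifetime ω [] + birthTime (subEvolution ω i) u

/-- The tree size `μ(t)`: the total number of nodes, living or dead, at time `t`. -/
noncomputable def treeSize (ω : Evolution) (t : ℝ) : ℕ∞ :=
  {u : List ℕ | IsNode ω u ∧ birthTime ω u ≤ t}.encard

/-- The law of the evolution started from a single living root: lifetimes are exponential with
parameter `Q`, offspring numbers have law `ν`, and all of them are independent. -/
noncomputable def evolutionLaw (ν : Measure ℕ) (Q : ℝ) : Measure Evolution :=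
  Measure.infinitePi fun _ : List ℕ => (expMeasure Q).prod ν

/-- The probability that the tree has exactly `n` nodes at time `t`. -/
noncomputable def sizeProb (ν : Measure ℕ) (Q : ℝ) (n : ℕ) (t : ℝ) : ℝ :=
  (evolutionLaw ν Q).real {ω | treeSize ω t = n}

/-- The probability `pₙ` that a stationary tree has exactly `n` nodes: the limit of
`sizeProb ν Q n t` as `t → ∞` (meaningful when this limit exists). -/
noncomputable def stationaryProb (ν : Measure ℕ) (Q : ℝ) (n : ℕ) : ℝ :=
  limUnder atTop (sizeProb ν Q n)

/-- The generating function `g(z) = ∑_{n ≥ 1} pₙ zⁿ` of the size of a stationary tree. -/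
noncomputable def stationaryGF (ν : Measure ℕ) (Q : ℝ) (z : ℝ) : ℝ :=
  ∑' n : ℕ, stationaryProb ν Q (n + 1) * z ^ (n + 1)

/-- The generating function `q(z) = E[z^ν]` of the offspring number. -/
noncomputable def offspringGF (ν : Measure ℕ) (z : ℝ) : ℝ := ∫ k : ℕ, z ^ k ∂ν

end RandomTree

/-! As `t → ∞` the set of nodes born by time `t` exhausts the nodes of the genealogical tree, so the
indicator of "size `n` at time `t`" is eventually that of "total size `n`". Hence `pₙ` exists and is
the law of the total progeny (`tendsto_sizeProb`); lifetimes play no further part.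

The subtrees of the root's children are independent copies of the tree, independent of the root's
offspring number. So the total size of `k` subtrees has generating function `g ^ k`, and
conditioning on the number of children gives `g = z q(g)` (`stationaryGF_eq`).

For Poisson offspring, `q₁ g(z)` solves `T = X exp T` at `X = q₁ e^{-q₁} z`. Comparing coefficients
gives `q₁ pₙ = Cₙ (q₁ e^{-q₁}) ^ n`, where `Cₙ` is the coefficient of the universal series `T`; the
maximum then follows from `1 + s < exp s`.

By continuity the limit of `g` at `1` is `g(1)`, a root of `x = exp (q₁ (x - 1))`. By the
intermediate value theorem it exceeds no positive root (`stationaryGF_one_le`), and convexity counts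
the roots. -/

namespace RandomTree

/-- The set of labels of the nodes that are eventually produced. -/
def nodes (ω : Evolution) : Set (List ℕ) := {u | IsNode ω u}

/-- The total number of nodes that are eventually produced. -/
noncomputable def totalSize (ω : Evolution) : ℕ∞ := (nodes ω).encard

/-- The number of nodes that descend from the first `k` potential children of the root. -/
noncomputable def forestSize (k : ℕ) (ω : Evolution) : ℕ∞ :=
  ∑ i ∈ Finset.range k, totalSize (subEvolution ω i)

/-! ### Measurability of the size events. -/

section Measurability

/-- A countable type has countably many finite subsets, so one can take the union over the possible
values of `A ω`. -/
theorem measurableSet_encard_eq {Ω ι : Type*} [MeasurableSpace Ω] [Countable ι]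
    (A : Ω → Set ι) (hA : ∀ u, MeasurableSet {ω | u ∈ A ω}) (n : ℕ) :
    MeasurableSet {ω | (A ω).encard = n} := by
  have h : {ω | (A ω).encard = n} =
      ⋃ s ∈ {s : Finset ι | s.card = n}, ⋂ u, {ω | u ∈ A ω ↔ u ∈ s} := by
    ext ω
    simp only [Set.mem_ofPred_eq, Set.mem_iUnion, Set.mem_iInter, exists_prop]
    constructor
    · intro h
      have hf : (A ω).Finite := Set.finite_of_encard_eq_coe h
      refine ⟨hf.toFinset, ?_, fun u => by simp⟩
      rw [hf.encard_eq_coe_toFinset_card] at h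
      exact_mod_cast h
    · rintro ⟨s, hs, h⟩
      have : A ω = s := by ext u; simpa using h u
      rw [this, Set.encard_coe_eq_coe_finsetCard, hs]
  rw [h]
  refine MeasurableSet.biUnion (Set.to_countable _) fun s _ => MeasurableSet.iInter fun u => ?_
  by_cases hu : u ∈ s
  · simpa [hu] using hA u
  · simp only [hu, iff_false]
    exact (hA u).compl

@[fun_prop]
theorem measurable_subEvolution (i : ℕ) : Measurable fun ω : Evolution => subEvolution ω i :=
  measurable_pi_lambda _ fun u => measurable_pi_apply (i :: u)

theorem measurableSet_isNode (u : List ℕ) : MeasurableSet {ω | IsNode ω u} := by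
  induction u with
  | nil => simp [IsNode]
  | cons i u ih =>
    refine MeasurableSet.inter ?_ (measurable_subEvolution i ih)
    exact (measurable_snd.comp (measurable_pi_apply [])) (measurableSet_Ioi (a := i))

theorem measurable_birthTime (u : List ℕ) : Measurable fun ω => birthTime ω u := by
  induction u with
  | nil => exact measurable_const
  | cons i u ih =>
    exact (measurable_fst.comp (measurable_pi_apply [])).add (ih.comp (measurable_subEvolution i))

theorem measurableSet_treeSize_eq (t : ℝ) (n : ℕ) : MeasurableSet {ω | treeSize ω t = n} :=
  measurableSet_encard_eq (fun ω => {u | IsNode ω u ∧ birthTime ω u ≤ t})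
    (fun u => (measurableSet_isNode u).inter (measurable_birthTime u measurableSet_Iic)) n

theorem measurableSet_totalSize_eq (n : ℕ) : MeasurableSet {ω | totalSize ω = n} :=
  measurableSet_encard_eq nodes measurableSet_isNode n

end Measurability

/-! ### Total size and its decomposition at the root. -/

/-- The eventual value of the tree size is the total size, whether this is finite or not. -/
theorem eventually_treeSize_eq_iff (ω : Evolution) (n : ℕ) :
    ∀ᶠ t in atTop, treeSize ω t = n ↔ totalSize ω = n := by
  have hev (s : Finset (List ℕ)) (hs : (s : Set (List ℕ)) ⊆ nodes ω) :
      ∀ᶠ t in atTop, (s : Set (List ℕ)) ⊆ {u | IsNode ω u ∧ birthTime ω u ≤ t} := by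
    have : ∀ᶠ t in atTop, ∀ u ∈ s, birthTime ω u ≤ t :=
      (Finset.eventually_all s).2 fun u _ => eventually_ge_atTop _
    filter_upwards [this] with t ht u hu using ⟨hs hu, ht u hu⟩
  have hsub (t : ℝ) : {u | IsNode ω u ∧ birthTime ω u ≤ t} ⊆ nodes ω := fun u hu => hu.1
  by_cases hf : (nodes ω).Finite
  · filter_upwards [hev hf.toFinset (by simp)] with t ht
    rw [hf.coe_toFinset] at ht
    rw [treeSize, totalSize, (hsub t).antisymm ht]
  -- In an infinite tree, `n + 1` nodes are eventually born, so both sides of the equivalence are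
  -- eventually false.
  · obtain ⟨s, hs, hc⟩ := Set.Infinite.exists_subset_card_eq hf (n + 1)
    filter_upwards [hev s hs] with t ht
    have h1 : ((n + 1 : ℕ) : ℕ∞) ≤ treeSize ω t := by
      rw [← hc, ← Set.encard_coe_eq_coe_finsetCard]
      exact Set.encard_le_encard ht
    have h2 : ((n + 1 : ℕ) : ℕ∞) ≤ totalSize ω := h1.trans (Set.encard_le_encard (hsub t))
    have hn : ¬ ((n + 1 : ℕ) : ℕ∞) ≤ n := by exact_mod_cast Nat.not_succ_le_self n
    exact ⟨fun h => absurd (h ▸ h1) hn, fun h => absurd (h ▸ h2) hn⟩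

theorem totalSize_pos (ω : Evolution) : totalSize ω ≠ 0 := by
  rw [totalSize, Ne, Set.encard_eq_zero, ← Ne, ← Set.nonempty_iff_ne_empty]
  exact ⟨[], trivial⟩

theorem totalSize_eq (ω : Evolution) :
    totalSize ω = forestSize (offspring ω []) ω + 1 := by
  have h : nodes ω = insert []
      (⋃ i ∈ (Finset.range (offspring ω []) : Set ℕ), List.cons i '' nodes (subEvolution ω i)) := by
    ext u
    cases u with
    | nil => simp [nodes, IsNode]
    | cons i u => simp [nodes, IsNode, and_comm]
  rw [totalSize, h, Set.encard_insert_of_notMem (by simp),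
    (Finset.finite_toSet _).encard_biUnion, finsum_mem_coe_finset, forestSize]
  · simp [totalSize, (List.cons_injective).encard_image]
  · intro i _ j _ hij
    simp only [Function.onFun, Set.disjoint_left]
    rintro _ ⟨u, _, rfl⟩ ⟨v, _, h⟩
    exact hij (by simpa using (List.cons.inj h).1.symm)

theorem forestSize_succ (k : ℕ) (ω : Evolution) :
    forestSize (k + 1) ω = forestSize k ω + totalSize (subEvolution ω k) :=
  Finset.sum_range_succ _ _

/-- Puts the event in convolution form; a sum in `ℕ∞` with a finite value has finite summands. -/
theorem setOf_forestSize_succ_eq (k n : ℕ) :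
    {ω | forestSize (k + 1) ω = n} = ⋃ p ∈ Finset.HasAntidiagonal.antidiagonal n,
      {ω | forestSize k ω = p.1} ∩ {ω | totalSize (subEvolution ω k) = p.2} := by
  ext ω
  simp only [forestSize_succ, Set.mem_ofPred_eq, Set.mem_iUnion, Set.mem_inter_iff, exists_prop,
    Finset.HasAntidiagonal.mem_antidiagonal, Prod.exists]
  constructor
  · intro h
    obtain ⟨a, ha⟩ := ENat.ne_top_iff_exists.1 (ne_top_of_le_ne_top (ENat.natCast_ne_top n)
      (h ▸ le_self_add : forestSize k ω ≤ n))
    obtain ⟨b, hb⟩ := ENat.ne_top_iff_exists.1 (ne_top_of_le_ne_top (ENat.natCast_ne_top n)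
      (h ▸ le_add_self : totalSize (subEvolution ω k) ≤ n))
    rw [← ha, ← hb] at h
    exact ⟨a, b, by exact_mod_cast h, ha.symm, hb.symm⟩
  · rintro ⟨a, b, h, ha, hb⟩
    rw [ha, hb, ← h, Nat.cast_add]

/-- The σ-algebra `m` is left free so that it can be the one generated by the labels below the first
`k` children, as independence requires. -/
theorem measurableSet_forestSize_eq (m : MeasurableSpace Evolution) (k : ℕ)
    (h : ∀ i < k, Measurable[m, MeasurableSpace.pi] fun ω : Evolution => subEvolution ω i) (n : ℕ) :
    MeasurableSet[m] {ω | forestSize k ω = n} := by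
  induction k generalizing n with
  | zero =>
    by_cases hn : (0 : ℕ∞) = n
    · simp [forestSize, hn]
    · simp [forestSize, hn]
  | succ k ih =>
    rw [setOf_forestSize_succ_eq]
    refine Finset.measurableSet_biUnion _ fun p _ => ?_
    exact (ih (fun i hi => h i (hi.trans k.lt_succ_self)) p.1).inter
      (h k k.lt_succ_self (measurableSet_totalSize_eq p.2))

/-- The information carried by the labels in `S`. -/
abbrev labelSigma (S : Set (List ℕ)) : MeasurableSpace Evolution :=
  ⨆ u ∈ S, MeasurableSpace.comap (fun ω : Evolution => ω u) inferInstance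

theorem measurable_apply_labelSigma {S : Set (List ℕ)} {u : List ℕ} (hu : u ∈ S) :
    Measurable[labelSigma S] fun ω : Evolution => ω u :=
  (comap_measurable _).mono
    (le_biSup (fun u => MeasurableSpace.comap (fun ω : Evolution => ω u) inferInstance) hu) le_rfl

theorem measurable_subEvolution_labelSigma {S : Set (List ℕ)} {i : ℕ} (h : ∀ u, i :: u ∈ S) :
    Measurable[labelSigma S] fun ω : Evolution => subEvolution ω i :=
  @measurable_pi_lambda _ _ _ (labelSigma S) _ _ fun u => measurable_apply_labelSigma (h u)

/-- The probability that exactly `n` nodes are eventually produced. -/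
noncomputable def totalProb (ν : Measure ℕ) (Q : ℝ) (n : ℕ) : ℝ :=
  (evolutionLaw ν Q).real {ω | totalSize ω = n}

theorem totalProb_zero (ν : Measure ℕ) (Q : ℝ) : totalProb ν Q 0 = 0 := by
  simp [totalProb, totalSize_pos]

theorem totalProb_nonneg (ν : Measure ℕ) (Q : ℝ) (n : ℕ) : 0 ≤ totalProb ν Q n := measureReal_nonneg

/-! ### Independence, self-similarity and the law of the total size. -/

section Law

variable (ν : Measure ℕ) [IsProbabilityMeasure ν] {Q : ℝ}

theorem isProbabilityMeasure_evolutionLaw (hQ : 0 < Q) :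
    IsProbabilityMeasure (evolutionLaw ν Q) := by
  have := isProbabilityMeasure_expMeasure hQ
  unfold evolutionLaw
  infer_instance

theorem indep_labelSigma (hQ : 0 < Q) {S T : Set (List ℕ)} (h : Disjoint S T) :
    Indep (labelSigma S) (labelSigma T) (evolutionLaw ν Q) := by
  have := isProbabilityMeasure_expMeasure hQ
  refine indep_iSup_of_disjoint (fun u => (measurable_pi_apply u).comap_le) ?_ h
  exact iIndepFun_infinitePi (P := fun _ : List ℕ => (expMeasure Q).prod ν)
    (X := fun _ x => x) fun _ => measurable_id

/-- Reindexing an i.i.d. family along the injection `u ↦ i :: u` preserves its law. -/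
theorem map_subEvolution (hQ : 0 < Q) (i : ℕ) :
    (evolutionLaw ν Q).map (fun ω => subEvolution ω i) = evolutionLaw ν Q := by
  have := isProbabilityMeasure_expMeasure hQ
  exact Measure.map_infinitePi_infinitePi_of_inj
    (P := fun _ : List ℕ => (expMeasure Q).prod ν) (List.cons_injective (a := i))

theorem evolutionLaw_real_offspring_eq (hQ : 0 < Q) (k : ℕ) :
    (evolutionLaw ν Q).real {ω | offspring ω [] = k} = ν.real {k} := by
  have := isProbabilityMeasure_expMeasure hQ
  have h : (evolutionLaw ν Q).map (fun ω => offspring ω []) = ν := by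
    have h1 : (evolutionLaw ν Q).map (fun ω => ω []) = (expMeasure Q).prod ν :=
      Measure.infinitePi_map_eval (fun _ : List ℕ => (expMeasure Q).prod ν) []
    have h2 : (fun ω : Evolution => offspring ω []) = Prod.snd ∘ fun ω => ω [] := rfl
    rw [h2, ← Measure.map_map measurable_snd (measurable_pi_apply _), h1, Measure.map_snd_prod]
    simp
  conv_rhs => rw [← h]
  rw [map_measureReal_apply (f := fun ω : Evolution => offspring ω [])
    (measurable_snd.comp (measurable_pi_apply [])) (measurableSet_singleton k)]
  rfl

theorem tendsto_sizeProb (hQ : 0 < Q) (n : ℕ) :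
    Tendsto (sizeProb ν Q n) atTop (𝓝 (totalProb ν Q n)) := by
  have := isProbabilityMeasure_evolutionLaw ν hQ
  refine (ENNReal.tendsto_toReal (measure_ne_top _ _)).comp ?_
  exact tendsto_measure_of_tendsto_indicator_of_isFiniteMeasure atTop (evolutionLaw ν Q)
    (fun t => measurableSet_treeSize_eq t n) fun ω => eventually_treeSize_eq_iff ω n

theorem stationaryProb_eq_totalProb (hQ : 0 < Q) (n : ℕ) :
    stationaryProb ν Q n = totalProb ν Q n :=
  (tendsto_sizeProb ν hQ n).limUnder_eq

theorem summable_totalProb (hQ : 0 < Q) :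
    Summable (totalProb ν Q) ∧ ∑' n, totalProb ν Q n ≤ 1 := by
  have := isProbabilityMeasure_evolutionLaw ν hQ
  have hs (s : Finset ℕ) : ∑ n ∈ s, totalProb ν Q n ≤ 1 := by
    unfold totalProb
    rw [← measureReal_biUnion_finset _ fun n _ => measurableSet_totalSize_eq n]
    · exact measureReal_le_one
    · intro a _ b _ hab
      refine Set.disjoint_left.2 fun ω h1 h2 => hab ?_
      simp only [Set.mem_ofPred_eq] at h1 h2
      exact_mod_cast h1.symm.trans h2
  exact ⟨summable_of_sum_le (totalProb_nonneg ν Q) hs,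
    Real.tsum_le_of_sum_le (totalProb_nonneg ν Q) hs⟩

/-- The power series whose coefficients are the probabilities of the total sizes. -/
noncomputable def totalSeries (ν : Measure ℕ) (Q : ℝ) : PowerSeries ℝ :=
  PowerSeries.mk (totalProb ν Q)

/-- Subtrees of distinct children use disjoint sets of labels, so their sizes are independent with a
common law; convolution is multiplication of power series. -/
theorem evolutionLaw_real_forestSize_eq (hQ : 0 < Q) (k n : ℕ) :
    (evolutionLaw ν Q).real {ω | forestSize k ω = n} =
      PowerSeries.coeff n (totalSeries ν Q ^ k) := by
  have := isProbabilityMeasure_evolutionLaw ν hQ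
  induction k generalizing n with
  | zero =>
    rw [pow_zero, PowerSeries.coeff_one]
    by_cases hn : n = 0
    · simp [forestSize, hn]
    · have : (0 : ℕ∞) ≠ n := by exact_mod_cast Ne.symm hn
      simp [forestSize, hn, this]
  | succ k ih =>
    have hmeas (a : ℕ) : MeasurableSet {ω | forestSize k ω = a} :=
      measurableSet_forestSize_eq _ k (fun i _ => measurable_subEvolution i) a
    have hmeas' (b : ℕ) : MeasurableSet {ω | totalSize (subEvolution ω k) = b} :=
      measurable_subEvolution k (measurableSet_totalSize_eq b)
    rw [setOf_forestSize_succ_eq, pow_succ, PowerSeries.coeff_mul, measureReal_biUnion_finset]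
    · refine Finset.sum_congr rfl fun p _ => ?_
      have hdisj : Disjoint {u : List ℕ | ∃ i < k, ∃ v, u = i :: v} {u | ∃ v, u = k :: v} := by
        rw [Set.disjoint_left]
        rintro _ ⟨i, hi, v, rfl⟩ ⟨w, hw⟩
        exact hi.ne (List.cons.inj hw).1
      have hind := (Indep_iff _ _ _).1 (indep_labelSigma ν hQ hdisj)
        {ω | forestSize k ω = p.1} {ω | totalSize (subEvolution ω k) = p.2}
        (measurableSet_forestSize_eq (labelSigma {u : List ℕ | ∃ i < k, ∃ v, u = i :: v}) k
          (fun i hi => measurable_subEvolution_labelSigma fun u => ⟨i, hi, u, rfl⟩) p.1)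
        ((measurable_subEvolution_labelSigma (S := {u | ∃ v, u = k :: v}) fun u => ⟨u, rfl⟩)
          (measurableSet_totalSize_eq p.2))
      rw [measureReal_def, hind, ENNReal.toReal_mul, ← measureReal_def, ih, totalSeries, PowerSeries.coeff_mk, totalProb]
      conv_rhs => rw [← map_subEvolution ν hQ k, map_measureReal_apply
        (measurable_subEvolution k) (measurableSet_totalSize_eq p.2)]
      rfl
    · rintro p _ q _ hpq
      refine Set.disjoint_left.2 fun ω h1 h2 => hpq (Prod.ext ?_ ?_)
      · exact_mod_cast h1.1.symm.trans h2.1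
      · exact_mod_cast h1.2.symm.trans h2.2
    · exact fun p _ => (hmeas p.1).inter (hmeas' p.2)

/-- The number of nodes is `n + 1` when the root has `k` children, for some `k`, and these have
`n` descendants in all. -/
theorem hasSum_totalProb_succ (hQ : 0 < Q) (n : ℕ) :
    HasSum (fun k => ν.real {k} * PowerSeries.coeff n (totalSeries ν Q ^ k))
      (totalProb ν Q (n + 1)) := by
  have := isProbabilityMeasure_evolutionLaw ν hQ
  have hset : {ω | totalSize ω = ((n + 1 : ℕ) : ℕ∞)} =
      ⋃ k : ℕ, {ω | offspring ω [] = k} ∩ {ω | forestSize k ω = n} := by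
    ext ω
    simp [totalSize_eq ω]
  have hoff (k : ℕ) : MeasurableSet {ω : Evolution | offspring ω [] = k} :=
    (measurable_snd.comp (measurable_pi_apply [])) (measurableSet_singleton k)
  have hterm (k : ℕ) : ν.real {k} * PowerSeries.coeff n (totalSeries ν Q ^ k) =
      (evolutionLaw ν Q).real ({ω | offspring ω [] = k} ∩ {ω | forestSize k ω = n}) := by
    have hdisj : Disjoint {([] : List ℕ)} {u | ∃ i v, u = i :: v} := by
      simp
    have hind := (Indep_iff _ _ _).1 (indep_labelSigma ν hQ hdisj)
      {ω | offspring ω [] = k} {ω | forestSize k ω = n}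
      ((measurable_snd.comp (measurable_apply_labelSigma (Set.mem_singleton [])))
        (measurableSet_singleton k))
      (measurableSet_forestSize_eq (labelSigma {u : List ℕ | ∃ i v, u = i :: v}) k
        (fun i _ => measurable_subEvolution_labelSigma fun u => ⟨i, u, rfl⟩) n)
    rw [measureReal_def (evolutionLaw ν Q), hind, ENNReal.toReal_mul, ← measureReal_def,
      ← measureReal_def,
      evolutionLaw_real_forestSize_eq ν hQ, evolutionLaw_real_offspring_eq ν hQ]
  simp_rw [hterm, totalProb, hset]
  have hU := measure_iUnion (μ := evolutionLaw ν Q)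
    (f := fun k : ℕ => {ω : Evolution | offspring ω [] = k} ∩ {ω | forestSize k ω = n})
    (fun i j hij => Set.disjoint_left.2 fun ω h1 h2 => hij (h1.1.symm.trans h2.1))
    (fun k => (hoff k).inter
      (measurableSet_forestSize_eq _ k (fun i _ => measurable_subEvolution i) n))
  rw [measureReal_def, hU, ENNReal.tsum_toReal_eq fun k => measure_ne_top _ _]
  exact ENNReal.hasSum_toReal (hU ▸ measure_ne_top _ _)

end Law

/-! ### Values of products and powers of power series. -/

theorem _root_.PowerSeries.hasSum_coeff_mul {A B : PowerSeries ℝ} {z a b : ℝ}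
    (hA : HasSum (fun n => PowerSeries.coeff n A * z ^ n) a)
    (hB : HasSum (fun n => PowerSeries.coeff n B * z ^ n) b) :
    HasSum (fun n => PowerSeries.coeff n (A * B) * z ^ n) (a * b) := by
  have hterm (n : ℕ) : PowerSeries.coeff n (A * B) * z ^ n =
      ∑ p ∈ Finset.HasAntidiagonal.antidiagonal n,
        PowerSeries.coeff p.1 A * z ^ p.1 * (PowerSeries.coeff p.2 B * z ^ p.2) := by
    rw [PowerSeries.coeff_mul, Finset.sum_mul]
    refine Finset.sum_congr rfl fun p hp => ?_
    rw [← Finset.HasAntidiagonal.mem_antidiagonal.1 hp, pow_add]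
    ring
  simp_rw [hterm]
  rw [← hA.tsum_eq, ← hB.tsum_eq,
    tsum_mul_tsum_eq_tsum_sum_antidiagonal_of_summable_norm hA.summable.norm hB.summable.norm]
  exact (summable_norm_sum_mul_antidiagonal_of_summable_norm
    hA.summable.norm hB.summable.norm).of_norm.hasSum

theorem _root_.PowerSeries.hasSum_coeff_pow {A : PowerSeries ℝ} {z a : ℝ}
    (hA : HasSum (fun n => PowerSeries.coeff n A * z ^ n) a) (k : ℕ) :
    HasSum (fun n => PowerSeries.coeff n (A ^ k) * z ^ n) (a ^ k) := by
  induction k with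
  | zero =>
    have h := hasSum_single (f := fun n => PowerSeries.coeff n (A ^ 0) * z ^ n) 0
      fun n hn => by simp [PowerSeries.coeff_one, hn]
    simpa using h
  | succ k ih => simpa only [pow_succ] using PowerSeries.hasSum_coeff_mul ih hA

/-- A double series of nonnegative terms may be summed in either order. -/
theorem hasSum_comm_of_nonneg {f : ℕ → ℕ → ℝ} (hf : ∀ i j, 0 ≤ f i j) {g h : ℕ → ℝ} {s : ℝ}
    (hg : ∀ i, HasSum (f i) (g i)) (hs : HasSum g s) (hh : ∀ j, HasSum (fun i => f i j) (h j)) :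
    HasSum h s := by
  have hsum : Summable (Function.uncurry f) :=
    (summable_prod_of_nonneg fun p => hf p.1 p.2).2
      ⟨fun i => (hg i).summable, hs.summable.congr fun i => ((hg i).tsum_eq).symm⟩
  have h1 : ∑' p, Function.uncurry f p = s := (hsum.hasSum.prod_fiberwise hg).unique hs
  have h2 : HasSum (Function.uncurry f ∘ Prod.swap) s :=
    (Equiv.prodComm ℕ ℕ).hasSum_iff.2 (h1 ▸ hsum.hasSum)
  exact h2.prod_fiberwise hh

theorem stationaryGF_zero (ν : Measure ℕ) (Q : ℝ) : stationaryGF ν Q 0 = 0 := by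
  simp [stationaryGF]

/-! ### The generating function and its functional equation. -/

section GeneratingFunction

variable (ν : Measure ℕ) [IsProbabilityMeasure ν] {Q : ℝ}

theorem hasSum_stationaryGF (hQ : 0 < Q) {z : ℝ} (hz : z ∈ Set.Icc (0 : ℝ) 1) :
    HasSum (fun n => totalProb ν Q n * z ^ n) (stationaryGF ν Q z) := by
  have hs : Summable fun n => totalProb ν Q n * z ^ n :=
    (summable_totalProb ν hQ).1.of_nonneg_of_le
      (fun n => mul_nonneg (totalProb_nonneg ν Q n) (pow_nonneg hz.1 n))
      (fun n => mul_le_of_le_one_right (totalProb_nonneg ν Q n) (pow_le_one₀ hz.1 hz.2))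
  have h := hs.hasSum
  rw [hs.tsum_eq_zero_add, totalProb_zero, zero_mul, zero_add] at h
  simp_rw [stationaryGF, stationaryProb_eq_totalProb ν hQ]
  exact h

theorem stationaryGF_mem_Icc (hQ : 0 < Q) {z : ℝ} (hz : z ∈ Set.Icc (0 : ℝ) 1) :
    stationaryGF ν Q z ∈ Set.Icc (0 : ℝ) 1 := by
  have h := hasSum_stationaryGF ν hQ hz
  obtain ⟨hs, h1⟩ := summable_totalProb ν hQ
  refine ⟨h.nonneg fun n => mul_nonneg (totalProb_nonneg ν Q n) (pow_nonneg hz.1 n), ?_⟩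
  refine (hasSum_le (fun n => ?_) h hs.hasSum).trans h1
  exact mul_le_of_le_one_right (totalProb_nonneg ν Q n) (pow_le_one₀ hz.1 hz.2)

theorem hasSum_stationaryProb (hQ : 0 < Q) :
    HasSum (fun n => stationaryProb ν Q (n + 1)) (stationaryGF ν Q 1) := by
  simp_rw [stationaryGF, one_pow, mul_one, stationaryProb_eq_totalProb ν hQ]
  exact ((summable_nat_add_iff 1).2 (summable_totalProb ν hQ).1).hasSum

/-- Weierstrass test with the summable majorant `pₙ`; the endpoint `1` is included. -/
theorem continuousOn_stationaryGF (hQ : 0 < Q) :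
    ContinuousOn (stationaryGF ν Q) (Set.Icc 0 1) := by
  unfold stationaryGF
  refine continuousOn_tsum (fun n => by fun_prop) (hasSum_stationaryProb ν hQ).summable ?_
  intro n z hz
  rw [stationaryProb_eq_totalProb ν hQ, Real.norm_of_nonneg
    (mul_nonneg (totalProb_nonneg ν Q _) (pow_nonneg hz.1 _))]
  exact mul_le_of_le_one_right (totalProb_nonneg ν Q _) (pow_le_one₀ hz.1 hz.2)

theorem hasSum_offspringGF {z : ℝ} (hz : z ∈ Set.Icc (0 : ℝ) 1) :
    HasSum (fun k => ν.real {k} * z ^ k) (offspringGF ν z) := by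
  have hint : Integrable (fun k : ℕ => z ^ k) ν := by
    refine Integrable.of_bound (C := 1) .of_discrete (.of_forall fun k => ?_)
    rw [Real.norm_of_nonneg (pow_nonneg hz.1 k)]
    exact pow_le_one₀ hz.1 hz.2
  have hs : Summable fun k => ν.real {k} * z ^ k := by
    refine Summable.of_nonneg_of_le (fun k => mul_nonneg measureReal_nonneg (pow_nonneg hz.1 k))
      (fun k => mul_le_of_le_one_right measureReal_nonneg (pow_le_one₀ hz.1 hz.2)) ?_
    refine summable_of_sum_le (c := 1) (fun k => measureReal_nonneg) fun s => ?_
    rw [sum_measureReal_singleton]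
    exact measureReal_le_one
  rw [offspringGF, integral_countable hint]
  exact hs.hasSum

/-- The functional equation for an arbitrary offspring law. -/
theorem stationaryGF_eq (hQ : 0 < Q) {z : ℝ} (hz : z ∈ Set.Icc (0 : ℝ) 1) :
    stationaryGF ν Q z = z * offspringGF ν (stationaryGF ν Q z) := by
  have hG : HasSum (fun n => PowerSeries.coeff n (totalSeries ν Q) * z ^ n)
      (stationaryGF ν Q z) := by
    simpa [totalSeries] using hasSum_stationaryGF ν hQ hz
  have hsucc : HasSum (fun n => totalProb ν Q (n + 1) * z ^ n)
      (offspringGF ν (stationaryGF ν Q z)) := by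
    refine hasSum_comm_of_nonneg
      (f := fun k n => ν.real {k} * (PowerSeries.coeff n (totalSeries ν Q ^ k) * z ^ n))
      (fun k n => mul_nonneg measureReal_nonneg (mul_nonneg ?_ (pow_nonneg hz.1 n)))
      (fun k => (PowerSeries.hasSum_coeff_pow hG k).mul_left _)
      (hasSum_offspringGF ν (stationaryGF_mem_Icc ν hQ hz)) fun n => ?_
    · rw [← evolutionLaw_real_forestSize_eq ν hQ]
      exact measureReal_nonneg
    · simpa only [mul_assoc] using (hasSum_totalProb_succ ν hQ n).mul_right (z ^ n)
  rw [← hsucc.tsum_eq, ← tsum_mul_left, stationaryGF]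
  refine tsum_congr fun n => ?_
  rw [stationaryProb_eq_totalProb ν hQ, pow_succ]
  ring

end GeneratingFunction

theorem offspringGF_poissonMeasure (r : ℝ≥0) {z : ℝ} (hz : z ∈ Set.Icc (0 : ℝ) 1) :
    offspringGF (poissonMeasure r) z = Real.exp (-(r : ℝ)) * Real.exp (r * z) := by
  refine (hasSum_offspringGF _ hz).unique ?_
  have h := (NormedSpace.expSeries_div_hasSum_exp (r * z : ℝ)).mul_left (Real.exp (-(r : ℝ)))
  rw [← Real.exp_eq_exp_ℝ] at h
  refine h.congr_fun fun k => ?_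
  rw [poissonMeasure_real_singleton, mul_pow]
  ring

/-! ### Explicit form of `pₙ` for Poisson offspring, and its maximum. -/

section Coefficients

/-- Polynomial approximations to the solution `T` of `T = X exp T`; the coefficients up to `X ^ m`
of the `m`-th one are those of `T`. -/
noncomputable def treeSeries : ℕ → PowerSeries ℚ
  | 0 => 0
  | m + 1 => PowerSeries.X *
      ∑ k ∈ Finset.range (m + 1), PowerSeries.C (1 / (k.factorial : ℚ)) * treeSeries m ^ k

/-- The `n`-th coefficient of the solution `T` of `T = X exp T`. -/
noncomputable def treeCoeff (n : ℕ) : ℚ := PowerSeries.coeff n (treeSeries n)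

theorem coeff_zero_treeSeries (m : ℕ) : PowerSeries.coeff 0 (treeSeries m) = 0 := by
  cases m <;> simp [treeSeries]

theorem coeff_succ_treeSeries_succ (m n : ℕ) :
    PowerSeries.coeff (n + 1) (treeSeries (m + 1)) =
      ∑ k ∈ Finset.range (m + 1),
        1 / (k.factorial : ℚ) * PowerSeries.coeff n (treeSeries m ^ k) := by
  simp [treeSeries, PowerSeries.coeff_succ_X_mul, map_sum]

theorem coeff_pow_nonneg {A : PowerSeries ℚ} (hA : ∀ n, 0 ≤ PowerSeries.coeff n A) (k n : ℕ) :
    0 ≤ PowerSeries.coeff n (A ^ k) := by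
  induction k generalizing n with
  | zero =>
    rw [pow_zero, PowerSeries.coeff_one]
    split_ifs <;> simp
  | succ k ih =>
    rw [pow_succ, PowerSeries.coeff_mul]
    exact Finset.sum_nonneg fun p _ => mul_nonneg (ih _) (hA _)

theorem coeff_treeSeries_nonneg (m n : ℕ) : 0 ≤ PowerSeries.coeff n (treeSeries m) := by
  induction m generalizing n with
  | zero => simp [treeSeries]
  | succ m ih =>
    cases n with
    | zero => rw [coeff_zero_treeSeries]
    | succ n =>
      rw [coeff_succ_treeSeries_succ]
      exact Finset.sum_nonneg fun k _ => mul_nonneg (by positivity) (coeff_pow_nonneg ih k n)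

/-- All terms of the recursion are nonnegative; the term `k = 0` (for the coefficient of `X`) or `k
= 1` (for later ones) is positive. -/
theorem coeff_treeSeries_pos {m n : ℕ} (hn : 1 ≤ n) (hnm : n ≤ m) :
    0 < PowerSeries.coeff n (treeSeries m) := by
  induction m generalizing n with
  | zero => omega
  | succ m ih =>
    obtain ⟨n, rfl⟩ := Nat.exists_eq_add_of_le' hn
    rw [coeff_succ_treeSeries_succ]
    refine Finset.sum_pos' (fun k _ => mul_nonneg (by positivity)
      (coeff_pow_nonneg (coeff_treeSeries_nonneg m) k n)) ?_
    rcases Nat.eq_zero_or_pos n with rfl | hn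
    · exact ⟨0, by simp, by simp⟩
    · refine ⟨1, by simp; omega, ?_⟩
      simpa using ih hn (by omega)

theorem treeCoeff_pos {n : ℕ} (hn : 1 ≤ n) : 0 < treeCoeff n :=
  coeff_treeSeries_pos hn le_rfl

/-- Rescaling of the coefficients of a power series and of its powers. -/
theorem coeff_pow_eq_of_coeff_eq {A : PowerSeries ℝ} {T : PowerSeries ℚ} {q r : ℝ} {m : ℕ}
    (h : ∀ n ≤ m, q * PowerSeries.coeff n A = PowerSeries.coeff n T * r ^ n) (k : ℕ) {n : ℕ}
    (hn : n ≤ m) :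
    q ^ k * PowerSeries.coeff n (A ^ k) = (PowerSeries.coeff n (T ^ k) : ℚ) * r ^ n := by
  induction k generalizing n with
  | zero =>
    simp only [pow_zero, PowerSeries.coeff_one]
    split_ifs with h <;> simp [h]
  | succ k ih =>
    rw [pow_succ A, pow_succ T, PowerSeries.coeff_mul, PowerSeries.coeff_mul, Finset.mul_sum,
      Rat.cast_sum, Finset.sum_mul]
    refine Finset.sum_congr rfl fun p hp => ?_
    have hp' := Finset.HasAntidiagonal.mem_antidiagonal.1 hp
    rw [Rat.cast_mul]
    calc q ^ (k + 1) * (PowerSeries.coeff p.1 (A ^ k) * PowerSeries.coeff p.2 A)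
        = (q ^ k * PowerSeries.coeff p.1 (A ^ k)) * (q * PowerSeries.coeff p.2 A) := by ring
      _ = _ := by
        rw [ih (by omega), h _ (by omega), ← hp', pow_add]
        ring

/-- Induction step of the comparison of `q g(z)` with `T (q e^{-q} z)`. The conclusion carries no
factor `q` on the left, so it still determines the probability at `q = 0`. -/
theorem totalProb_poissonMeasure_succ_aux {Q : ℝ} (hQ : 0 < Q) (q : ℝ≥0) {m : ℕ}
    (h : ∀ n ≤ m, (q : ℝ) * totalProb (poissonMeasure q) Q n =
      PowerSeries.coeff n (treeSeries m) * (Real.exp (-(q : ℝ)) * q) ^ n) {n : ℕ} (hn : n ≤ m) :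
    totalProb (poissonMeasure q) Q (n + 1) =
      Real.exp (-(q : ℝ)) * PowerSeries.coeff (n + 1) (treeSeries (m + 1)) *
        (Real.exp (-(q : ℝ)) * q) ^ n := by
  -- Since `p₀ = 0`, the `k`-th power of the series is divisible by `X ^ k`; only `k ≤ m`
  -- contribute, which matches the truncation in `treeSeries`.
  have hvanish (k : ℕ) (hk : k ∉ Finset.range (m + 1)) :
      (poissonMeasure q).real {k} *
        PowerSeries.coeff n (totalSeries (poissonMeasure q) Q ^ k) = 0 := by
    have hX : PowerSeries.X ∣ totalSeries (poissonMeasure q) Q := by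
      rw [PowerSeries.X_dvd_iff, ← PowerSeries.coeff_zero_eq_constantCoeff_apply]
      simp [totalSeries, totalProb_zero]
    rw [PowerSeries.X_pow_dvd_iff.1 (pow_dvd_pow_of_dvd hX k) n
      (by simp at hk; omega), mul_zero]
  rw [(hasSum_totalProb_succ (poissonMeasure q) hQ n).unique
    (hasSum_sum_of_ne_finset_zero hvanish), coeff_succ_treeSeries_succ, Rat.cast_sum,
    Finset.mul_sum, Finset.sum_mul]
  refine Finset.sum_congr rfl fun k _ => ?_
  have hk := coeff_pow_eq_of_coeff_eq (A := totalSeries (poissonMeasure q) Q)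
    (T := treeSeries m) (q := q) (r := Real.exp (-(q : ℝ)) * q) (m := m)
    (by simpa [totalSeries] using h) k hn
  rw [poissonMeasure_real_singleton]
  push_cast
  calc Real.exp (-(q : ℝ)) * (q : ℝ) ^ k / (k.factorial : ℝ) *
        PowerSeries.coeff n (totalSeries (poissonMeasure q) Q ^ k)
      = Real.exp (-(q : ℝ)) * (1 / (k.factorial : ℝ)) *
        ((q : ℝ) ^ k * PowerSeries.coeff n (totalSeries (poissonMeasure q) Q ^ k)) := by ring
    _ = _ := by rw [hk]; ring

theorem mul_totalProb_poissonMeasure {Q : ℝ} (hQ : 0 < Q) (q : ℝ≥0) {m n : ℕ} (hn : n ≤ m) :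
    (q : ℝ) * totalProb (poissonMeasure q) Q n =
      PowerSeries.coeff n (treeSeries m) * (Real.exp (-(q : ℝ)) * q) ^ n := by
  induction m generalizing n with
  | zero => simp [Nat.le_zero.1 hn, totalProb_zero, coeff_zero_treeSeries]
  | succ m ih =>
    cases n with
    | zero => simp [totalProb_zero, coeff_zero_treeSeries]
    | succ n =>
      rw [totalProb_poissonMeasure_succ_aux hQ q (fun j hj => ih hj) (Nat.le_of_succ_le_succ hn),
        pow_succ]
      ring

theorem stationaryProb_poissonMeasure_succ {Q : ℝ} (hQ : 0 < Q) (q : ℝ≥0) (n : ℕ) :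
    stationaryProb (poissonMeasure q) Q (n + 1) =
      Real.exp (-(q : ℝ)) * treeCoeff (n + 1) * (Real.exp (-(q : ℝ)) * q) ^ n := by
  rw [stationaryProb_eq_totalProb _ hQ]
  exact totalProb_poissonMeasure_succ_aux hQ q
    (fun j hj => mul_totalProb_poissonMeasure hQ q hj) le_rfl

theorem stationaryProb_poissonMeasure {Q : ℝ} (hQ : 0 < Q) {q : ℝ≥0} (hq : 0 < q) (n : ℕ) :
    stationaryProb (poissonMeasure q) Q n =
      (treeCoeff n : ℝ) * (q : ℝ)⁻¹ * (Real.exp (-(q : ℝ)) * q) ^ n := by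
  have hq' : (q : ℝ) ≠ 0 := by exact_mod_cast hq.ne'
  rw [stationaryProb_eq_totalProb _ hQ, mul_right_comm, treeCoeff,
    ← mul_totalProb_poissonMeasure hQ q le_rfl]
  field_simp

/-- The function `x ↦ exp (-x) (exp (-x) x) ^ n` has a strict maximum at `n / (n + 1)`. -/
theorem exp_mul_pow_lt {n : ℕ} {m q : ℝ} (hm : m = 1 - 1 / ((n + 1 : ℕ) : ℝ)) (hq : 0 ≤ q)
    (hne : q ≠ m) :
    Real.exp (-q) * (Real.exp (-q) * q) ^ n < Real.exp (-m) * (Real.exp (-m) * m) ^ n := by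
  have hn1 : (0 : ℝ) < n + 1 := by positivity
  have hm' : m * (n + 1) = n := by
    rw [hm]; push_cast; field_simp; ring
  rcases Nat.eq_zero_or_pos n with rfl | hn
  · have hm0 : m = 0 := by simpa using hm'
    subst hm0
    simpa using lt_of_le_of_ne hq hne.symm
  · have hn0 : (0 : ℝ) < n := by exact_mod_cast hn
    have hmpos : 0 < m := pos_of_mul_pos_left (by rw [hm']; exact hn0) hn1.le
    -- The strict inequality `1 + s < exp s` at `s = q / m - 1`; its `n`-th power suffices because
    -- `n / m = n + 1`.
    have h1 : q / m < Real.exp (q / m - 1) := by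
      have := Real.add_one_lt_exp (x := q / m - 1)
        (by rw [sub_ne_zero, Ne, div_eq_one_iff_eq hmpos.ne']; exact hne)
      linarith
    have h2 : (q / m) ^ n < Real.exp (q / m - 1) ^ n :=
      pow_lt_pow_left₀ h1 (by positivity) hn.ne'
    have h3 : Real.exp (q / m - 1) ^ n = Real.exp ((n + 1) * q - (n + 1) * m) := by
      have : n * (q / m - 1) = (n + 1) * q - (n + 1) * m := by
        conv_lhs => rw [← hm']
        field_simp
      rw [← Real.exp_nat_mul, this]
    have h4 (x : ℝ) : Real.exp (-x) * (Real.exp (-x) * x) ^ n =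
        Real.exp (-((n + 1) * x)) * x ^ n := by
      rw [mul_pow, ← mul_assoc, ← Real.exp_nat_mul, ← Real.exp_add]
      congr 2
      ring
    rw [h3, div_pow, div_lt_iff₀ (by positivity), Real.exp_sub] at h2
    rw [h4, h4, Real.exp_neg, Real.exp_neg]
    have he := Real.exp_pos ((n + 1) * q)
    calc (Real.exp ((n + 1) * q))⁻¹ * q ^ n
        < (Real.exp ((n + 1) * q))⁻¹ *
          (Real.exp ((n + 1) * q) / Real.exp ((n + 1) * m) * m ^ n) := by gcongr
      _ = _ := by field_simp

theorem stationaryProb_poissonMeasure_lt {Q : ℝ} (hQ : 0 < Q) {n : ℕ} (hn : 1 ≤ n) {m q : ℝ≥0}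
    (hm : (m : ℝ) = 1 - 1 / (n : ℝ)) (hq : q ≠ m) :
    stationaryProb (poissonMeasure q) Q n < stationaryProb (poissonMeasure m) Q n := by
  obtain ⟨n, rfl⟩ := Nat.exists_eq_add_of_le' hn
  rw [stationaryProb_poissonMeasure_succ hQ, stationaryProb_poissonMeasure_succ hQ]
  have hC : (0 : ℝ) < treeCoeff (n + 1) := by exact_mod_cast treeCoeff_pos hn
  rw [mul_right_comm (Real.exp (-(q : ℝ))), mul_right_comm (Real.exp (-(m : ℝ)))]
  exact mul_lt_mul_of_pos_right
    (exp_mul_pow_lt hm q.coe_nonneg (NNReal.coe_injective.ne hq)) hC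

end Coefficients

/-! ### Roots of `x = exp (q (x - 1))` in the unit interval. -/

section Roots

/-- The strictly convex function `exp (q (x - 1))` meets the diagonal at `x` and at `1`, so it lies
strictly below it in between. Thus there is at most one root below `1`. -/
theorem exp_fixed_lt_of_lt {q x y : ℝ} (hxy : x < y) (hy : y < 1) (hq : 0 < q)
    (hx : x = Real.exp (-q) * Real.exp (q * x)) : Real.exp (-q) * Real.exp (q * y) < y := by
  rw [← Real.exp_add] at hx ⊢
  have hx1 : 0 < 1 - x := by linarith
  have hx1' : 1 - x ≠ 0 := hx1.ne'
  have hconv := strictConvexOn_exp.2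
  have h := hconv (Set.mem_univ (-q + q * x)) (Set.mem_univ 0)
    (by nlinarith : -q + q * x ≠ 0) (a := (1 - y) / (1 - x)) (b := (y - x) / (1 - x))
    (div_pos (by linarith) hx1) (div_pos (by linarith) hx1) (by field_simp; ring)
  simp only [smul_eq_mul, Real.exp_zero, ← hx] at h
  have hl : (1 - y) / (1 - x) * (-q + q * x) + (y - x) / (1 - x) * 0 = -q + q * y := by
    field_simp
    ring
  have hr : (1 - y) / (1 - x) * x + (y - x) / (1 - x) * 1 = y := by
    field_simp
    ring
  rwa [hl, hr] at h

theorem setOf_exp_fixed_of_le_one {q : ℝ} (hq : 0 < q) (hq1 : q ≤ 1) :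
    {x ∈ Set.Icc (0 : ℝ) 1 | x = Real.exp (-q) * Real.exp (q * x)} = {1} := by
  ext x
  simp only [Set.mem_ofPred_eq, Set.mem_Icc, Set.mem_singleton_iff]
  constructor
  · rintro ⟨⟨h0, h1⟩, hx⟩
    by_contra hne
    have hlt : x < 1 := lt_of_le_of_ne h1 hne
    rw [← Real.exp_add] at hx
    -- As `q ≤ 1` and `x < 1`, the tangent at `1` already satisfies `1 + q (x - 1) ≥ x`.
    have := Real.add_one_lt_exp (x := -q + q * x) (by nlinarith)
    nlinarith
  · rintro rfl
    refine ⟨by simp, ?_⟩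
    rw [← Real.exp_add]; simp

theorem exists_setOf_exp_fixed_of_one_lt {q : ℝ} (hq : 1 < q) :
    ∃ g : ℝ, 0 < g ∧ g < 1 ∧
      {x ∈ Set.Icc (0 : ℝ) 1 | x = Real.exp (-q) * Real.exp (q * x)} = {g, 1} := by
  have hq0 : 0 < q := by linarith
  have hlog : Real.log q < q - 1 := Real.log_lt_sub_one_of_pos hq0 hq.ne'
  have hlog0 : 0 < Real.log q := Real.log_pos hq
  -- The point where `exp (q (x - 1))` has slope `1`; its value there is `1 / q < y`, so the curve
  -- has crossed the diagonal on `[0, y]`.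
  set y : ℝ := 1 - Real.log q / q with hy
  have hy0 : 1 / q < y := by
    rw [hy, div_lt_iff₀ hq0, sub_mul, div_mul_cancel₀ _ hq0.ne']
    linarith
  have hy1 : y < 1 := by
    have : 0 < Real.log q / q := div_pos hlog0 hq0
    linarith
  have hyq : Real.exp (-q) * Real.exp (q * y) = 1 / q := by
    rw [← Real.exp_add, hy, mul_sub, mul_div_cancel₀ _ hq0.ne', mul_one, ← add_sub_assoc,
      neg_add_cancel, zero_sub, Real.exp_neg, Real.exp_log hq0, one_div]
  have hypos : 0 ≤ y := le_trans (by positivity) hy0.le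
  obtain ⟨g, ⟨hg0, hgy⟩, hg⟩ := intermediate_value_Icc' hypos
    (f := fun x => Real.exp (-q) * Real.exp (q * x) - x) (by fun_prop)
    (show (0 : ℝ) ∈ Set.Icc _ _ by
      constructor
      · simp only [hyq]; linarith
      · simp only [mul_zero, Real.exp_zero]; linarith [Real.exp_pos (-q)])
  have hgeq : g = Real.exp (-q) * Real.exp (q * g) := by simp only at hg; linarith
  have hg1 : g < 1 := hgy.trans_lt hy1
  refine ⟨g, hgeq ▸ by positivity, hg1, ?_⟩
  ext x
  simp only [Set.mem_ofPred_eq, Set.mem_Icc, Set.mem_insert_iff, Set.mem_singleton_iff]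
  constructor
  · rintro ⟨⟨h0, h1⟩, hx⟩
    by_contra! hne
    have hx1 := lt_of_le_of_ne h1 hne.2
    rcases lt_or_gt_of_ne hne.1 with h | h
    · have := exp_fixed_lt_of_lt h hg1 hq0 hx
      linarith
    · have := exp_fixed_lt_of_lt h hx1 hq0 hgeq
      linarith
  · rintro (rfl | rfl)
    · exact ⟨⟨hg0, hg1.le⟩, hgeq⟩
    · refine ⟨by simp, ?_⟩
      rw [← Real.exp_add]; simp

end Roots

/-! ### The limit of the generating function at `1`. -/

section Limit

variable {Q : ℝ}

theorem stationaryGF_poissonMeasure_eq (hQ : 0 < Q) (q : ℝ≥0) {z : ℝ}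
    (hz : z ∈ Set.Icc (0 : ℝ) 1) :
    stationaryGF (poissonMeasure q) Q z =
      z * Real.exp (-(q : ℝ)) * Real.exp (q * stationaryGF (poissonMeasure q) Q z) := by
  conv_lhs => rw [stationaryGF_eq (poissonMeasure q) hQ hz,
    offspringGF_poissonMeasure q (stationaryGF_mem_Icc _ hQ hz)]
  ring

theorem stationaryGF_one_mem (hQ : 0 < Q) (q : ℝ≥0) :
    stationaryGF (poissonMeasure q) Q 1 ∈
      {x ∈ Set.Icc (0 : ℝ) 1 | x = Real.exp (-(q : ℝ)) * Real.exp (q * x)} := by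
  have h1 : (1 : ℝ) ∈ Set.Icc (0 : ℝ) 1 := by simp
  refine ⟨stationaryGF_mem_Icc _ hQ h1, ?_⟩
  simpa only [one_mul] using stationaryGF_poissonMeasure_eq hQ q h1

theorem tendsto_stationaryGF_one (ν : Measure ℕ) [IsProbabilityMeasure ν] (hQ : 0 < Q) :
    Tendsto (stationaryGF ν Q) (𝓝[<] 1) (𝓝 (stationaryGF ν Q 1)) := by
  have h := continuousOn_stationaryGF ν hQ 1 (by simp)
  rw [ContinuousWithinAt, nhdsWithin_Icc_eq_nhdsLE one_pos] at h
  exact h.mono_left (nhdsWithin_mono _ Set.Iio_subset_Iic_self)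

/-- The value at `1` of the generating function is the smallest root. -/
theorem stationaryGF_one_le (hQ : 0 < Q) (q : ℝ≥0) {g : ℝ} (hg0 : 0 < g)
    (hg : g = Real.exp (-(q : ℝ)) * Real.exp (q * g)) :
    stationaryGF (poissonMeasure q) Q 1 ≤ g := by
  refine le_of_tendsto (tendsto_stationaryGF_one _ hQ) ?_
  filter_upwards [Ioo_mem_nhdsLT (zero_lt_one' ℝ)] with z hz
  by_contra! hlt
  -- If the generating function exceeded `g` at some `z < 1`, it would equal `g` at some `w ≤ z`;
  -- the functional equation then reads `g = w * g`, forcing `w = 1`.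
  obtain ⟨w, hw, hwg⟩ := intermediate_value_Icc hz.1.le
    ((continuousOn_stationaryGF (poissonMeasure q) hQ).mono (Set.Icc_subset_Icc_right hz.2.le))
    (show g ∈ Set.Icc _ _ from ⟨by rw [stationaryGF_zero]; exact hg0.le, hlt.le⟩)
  have h := stationaryGF_poissonMeasure_eq hQ q
    (show w ∈ Set.Icc (0 : ℝ) 1 from ⟨hw.1, hw.2.trans hz.2.le⟩)
  rw [hwg, mul_assoc, ← hg] at h
  nlinarith [hw.2, hz.2]

end Limit

end RandomTree

/-! ### Assembly of the theorem. -/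

theorem mainTheorem9 :
    ∃ C : ℕ → ℚ, (∀ n : ℕ, 1 ≤ n → 0 < C n) ∧
    ∀ Q : ℝ, 0 < Q →
      -- existence of the limit probabilities
      (∀ (q₁ : ℝ≥0) (n : ℕ),
        Tendsto (RandomTree.sizeProb (poissonMeasure q₁) Q n) atTop
          (𝓝 (RandomTree.stationaryProb (poissonMeasure q₁) Q n))) ∧
      -- the functional equation
      (∀ q₁ : ℝ≥0, 0 < q₁ → ∀ z ∈ Set.Icc (0 : ℝ) 1,
        RandomTree.stationaryGF (poissonMeasure q₁) Q z =
          z * RandomTree.offspringGF (poissonMeasure q₁)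
            (RandomTree.stationaryGF (poissonMeasure q₁) Q z) ∧
        RandomTree.stationaryGF (poissonMeasure q₁) Q z =
          z * Real.exp (-(q₁ : ℝ)) *
            Real.exp (q₁ * RandomTree.stationaryGF (poissonMeasure q₁) Q z)) ∧
      -- the limit at `1` when `q₁ ≤ 1`
      (∀ q₁ : ℝ≥0, 0 < q₁ → q₁ ≤ 1 →
        {x ∈ Set.Icc (0 : ℝ) 1 | x = Real.exp (-(q₁ : ℝ)) * Real.exp (q₁ * x)} = {1} ∧
        Tendsto (RandomTree.stationaryGF (poissonMeasure q₁) Q) (𝓝[<] 1) (𝓝 1) ∧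
        HasSum (fun n : ℕ => RandomTree.stationaryProb (poissonMeasure q₁) Q (n + 1)) 1) ∧
      -- the limit at `1` when `1 < q₁`
      (∀ q₁ : ℝ≥0, 1 < q₁ → ∃ g₂ : ℝ, g₂ < 1 ∧
        {x ∈ Set.Icc (0 : ℝ) 1 | x = Real.exp (-(q₁ : ℝ)) * Real.exp (q₁ * x)} = {g₂, 1} ∧
        Tendsto (RandomTree.stationaryGF (poissonMeasure q₁) Q) (𝓝[<] 1) (𝓝 g₂) ∧
        HasSum (fun n : ℕ => RandomTree.stationaryProb (poissonMeasure q₁) Q (n + 1)) g₂) ∧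
      -- the form of the probabilities
      (∀ q₁ : ℝ≥0, 0 < q₁ → ∀ n : ℕ, 1 ≤ n →
        RandomTree.stationaryProb (poissonMeasure q₁) Q n =
          (C n : ℝ) * (q₁ : ℝ)⁻¹ * (Real.exp (-(q₁ : ℝ)) * q₁) ^ n) ∧
      -- the maximum as a function of `q₁`
      (∀ n : ℕ, 1 ≤ n → ∀ m : ℝ≥0, (m : ℝ) = 1 - 1 / (n : ℝ) → ∀ q₁ : ℝ≥0, q₁ ≠ m →
        RandomTree.stationaryProb (poissonMeasure q₁) Q n <
          RandomTree.stationaryProb (poissonMeasure m) Q n) := by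
  refine ⟨RandomTree.treeCoeff, fun n hn => RandomTree.treeCoeff_pos hn, fun Q hQ => ?_⟩
  refine ⟨fun q n => ?_, fun q hq z hz => ⟨RandomTree.stationaryGF_eq _ hQ hz,
    RandomTree.stationaryGF_poissonMeasure_eq hQ q hz⟩, fun q hq hq1 => ?_, fun q hq => ?_,
    fun q hq n _ => RandomTree.stationaryProb_poissonMeasure hQ hq n,
    fun n hn m hm q hq => RandomTree.stationaryProb_poissonMeasure_lt hQ hn hm hq⟩
  · rw [RandomTree.stationaryProb_eq_totalProb _ hQ]
    exact RandomTree.tendsto_sizeProb _ hQ n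
  · have hroots := RandomTree.setOf_exp_fixed_of_le_one (q := q) (by exact_mod_cast hq)
      (by exact_mod_cast hq1)
    have h1 : RandomTree.stationaryGF (poissonMeasure q) Q 1 = 1 := by
      have hmem := RandomTree.stationaryGF_one_mem hQ q
      rwa [hroots] at hmem
    refine ⟨hroots, ?_, ?_⟩
    · simpa only [h1] using RandomTree.tendsto_stationaryGF_one (poissonMeasure q) hQ
    · simpa only [h1] using RandomTree.hasSum_stationaryProb (poissonMeasure q) hQ
  · obtain ⟨g, hg0, hg1, hroots⟩ :=
      RandomTree.exists_setOf_exp_fixed_of_one_lt (q := q) (by exact_mod_cast hq)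
    have hmem := RandomTree.stationaryGF_one_mem hQ q
    have hg : g ∈ {x ∈ Set.Icc (0 : ℝ) 1 | x = Real.exp (-(q : ℝ)) * Real.exp (q * x)} := by
      rw [hroots]; simp
    have hle := RandomTree.stationaryGF_one_le hQ q hg0 hg.2
    have h1 : RandomTree.stationaryGF (poissonMeasure q) Q 1 = g := by
      rw [hroots] at hmem
      exact hmem.resolve_right fun h => (hle.trans_lt hg1).ne h
    refine ⟨g, hg1, hroots, ?_, ?_⟩
    · simpa only [h1] using RandomTree.tendsto_stationaryGF_one (poissonMeasure q) hQ
    · simpa only [h1] using RandomTree.hasSum_stationaryProb (poissonMeasure q) hQ
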